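/- Let $\alpha$ be an almost periodic minimal homeomorphism of an infinite compact metric space $\Theta$, let $\mathbb I=[0,1]$, and let $f:\Theta\times\mathbb I\to\Theta\times\mathbb I$ be an $\alpha$-forced increasing interval map, that is, $f$ is continuous and $f(\theta,x)=(\alpha(\theta),f_\theta(x))$ with every $f_\theta:\mathbb I\to\mathbb I$ strictly increasing. Let $\gamma:\Theta\to\operatorname{int}\mathbb I=(0,1)$ be continuous and such that its graph $\Gamma=\{(\theta,\gamma(\theta))\mid\theta\in\Theta\}$ satisfies $f(\Gamma)=\Gamma$. Then there exist a map $\hat f:\Theta\times\mathbb I\to\Theta\times\mathbb I$ and a continuous surjection $h:\Theta\times\mathbb I\to\Theta\times\mathbb I$ of the form $h(\theta,x)=(\theta,h_\theta(x))$ with $h\circ\hat f=f\circ h$ (so $\hat f$ is a topological extension of $f$ with factor map $h$) such that: (i) $\hat f$ is an $\alpha$-forced increasing interval map; (ii) all the fibre maps $h_\theta$ are non-decreasing; (iii) $h$ is injective on the complement of $h^{-1}(\Gamma)$; (iv) for a countably infinite set of points of $\Gamma$ the preimage under $h$ is a vertical segment $\{\theta\}\times[a,b]$ with $a<b$, and for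 all other points of $\Gamma$ it is a singleton; (v) $h^{-1}(\Gamma)$ does not contain the graph of any continuous function $\eta:\Theta\to\mathbb I$; (vi) $h^{-1}(\Gamma)$ is pinched, i.e. for some $\theta\in\Theta$ there is exactly one $x\in\mathbb I$ with $(\theta,x)\in h^{-1}(\Gamma)$; and $h^{-1}(\Gamma)$ contains a minimal set $M$ of $\hat f$ such that $\hat f|_M$ is a homeomorphism of $M$ that is almost automorphic but not almost periodic. Here a homeomorphism $g$ of a compact metric space $(X,d)$ is minimal if every orbit $\{g^n(x)\mid n\in\mathbb Z\}$ is dense; it is almost periodic if for every $\varepsilon>0$ the set $\{n\in\mathbb Z\mid \sup_{x}d(g^n(x),x)<\varepsilon\}$ is syndetic (has uniformly bounded gaps in $\mathbb Z$); and it is almost automorphic if there is a point $x\in X$ such that, whenever $g^{n_k}(x)\to\tilde x$ for a sequence of integers $(n_k)$, then $g^{-n_k}(\tilde x)\to x$. A minimal set is a nonempty closed invariant set with no proper nonempty closed invariant subset. -/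

import Mathlib

open Filter Topology

/-- The graph `{(θ, γ θ) | θ ∈ Θ}` of a function from the base to the unit interval. -/
def curveGraph {Θ : Type*} (γ : Θ → unitInterval) : Set (Θ × unitInterval) :=
  {p | p.2 = γ p.1}

/-- The vertical fibre `A_θ = {x | (θ, x) ∈ A}`. -/
def verticalFibre {Θ : Type*} (A : Set (Θ × unitInterval)) (θ : Θ) : Set unitInterval :=
  {x | (θ, x) ∈ A}

/-- `A` is pinched if some fibre `A_θ` consists of exactly one point. -/
def IsPinched {Θ : Type*} (A : Set (Θ × unitInterval)) : Prop :=
  ∃ θ, (verticalFibre A θ).encard = 1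

/-- A set of integers is syndetic if its gaps are uniformly bounded. -/
def IsSyndetic (A : Set ℤ) : Prop :=
  ∃ L : ℕ, ∀ n : ℤ, ∃ m ∈ A, n ≤ m ∧ m ≤ n + L

/-- A homeomorphism is minimal if every (two-sided) orbit is dense. -/
def IsMinimalHomeo {X : Type*} [TopologicalSpace X] (g : X ≃ₜ X) : Prop :=
  ∀ x, Dense (Set.range fun n : ℤ => (g ^ n) x)

/-- A homeomorphism of a metric space is almost periodic if for every `ε > 0` the set of
integers `n` for which `g ^ n` is uniformly `ε`-close to the identity is syndetic. -/
def IsAlmostPeriodic {X : Type*} [MetricSpace X] (g : X ≃ₜ X) : Prop :=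
  ∀ ε : ℝ, 0 < ε → IsSyndetic {n : ℤ | ∀ x, dist ((g ^ n) x) x < ε}

/-- A homeomorphism is almost automorphic if there is a point `x` such that whenever
`g ^ (n k) x` converges to some `y` for a sequence of integers `n k`, then
`g ^ (- n k) y` converges to `x`. -/
def IsAlmostAutomorphic {X : Type*} [TopologicalSpace X] (g : X ≃ₜ X) : Prop :=
  ∃ x, ∀ (n : ℕ → ℤ) (y : X),
    Tendsto (fun k => (g ^ n k) x) atTop (𝓝 y) →
      Tendsto (fun k => (g ^ (-n k)) y) atTop (𝓝 x)

/-- `M` is a minimal set of the map `g`: a nonempty closed invariant set without proper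
nonempty closed invariant subsets. -/
structure IsMinimalSet {X : Type*} [TopologicalSpace X] (g : X → X) (M : Set X) : Prop where
  nonempty : M.Nonempty
  isClosed : IsClosed M
  invariant : g '' M = M
  minimal : ∀ K : Set X, K ⊆ M → K.Nonempty → IsClosed K → Set.MapsTo g K K → K = M

/-- The restriction of `g` to `M` is a homeomorphism of `M` that is almost periodic. -/
def IsAlmostPeriodicOn {X : Type*} [MetricSpace X] (g : X → X) (M : Set X) : Prop :=
  ∃ φ : M ≃ₜ M, (∀ p : M, ((φ p : M) : X) = g p) ∧ IsAlmostPeriodic φ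

/-- The restriction of `g` to `M` is a homeomorphism of `M` that is almost automorphic. -/
def IsAlmostAutomorphicOn {X : Type*} [MetricSpace X] (g : X → X) (M : Set X) : Prop :=
  ∃ φ : M ≃ₜ M, (∀ p : M, ((φ p : M) : X) = g p) ∧ IsAlmostAutomorphic φ

/-- `f` is an `α`-forced increasing interval map with fibre `[0, 1]`: a continuous skew product
`f (θ, x) = (α θ, f_θ x)` whose fibre maps `f_θ` are strictly increasing (they need not be
surjective). -/
structure IsForcedIncreasing {Θ : Type*} [TopologicalSpace Θ] (α : Θ ≃ₜ Θ)
    (f : Θ × unitInterval → Θ × unitInterval) : Prop where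
  continuous : Continuous f
  fst_eq : ∀ p, (f p).1 = α p.1
  strictMono : ∀ θ, StrictMono fun x => (f (θ, x)).2

/-- `h` is a factor map (semiconjugacy) from `g` on `X` to `f` on `Y`;
equivalently, `g` is a topological extension of `f` via `h`. -/
structure IsFactorMap {X Y : Type*} [TopologicalSpace X] [TopologicalSpace Y]
    (h : X → Y) (g : X → X) (f : Y → Y) : Prop where
  continuous : Continuous h
  surjective : Function.Surjective h
  semiconj : h ∘ g = f ∘ h

/-! The extension is a Denjoy-type blow-up of one orbit on Γ. Take a non-isolated `θ₀`, a base point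
`θs` off its orbit, and let `p n` be the point of Γ over `(α ^ n) θ₀`. A function `ρ 0`, continuous
off `p 0` and monotone on fibres, oscillates along Γ at `p 0` (`exists_isFibreJump_not_tendsto`); it
is transported so that `ρ (n + 1) ∘ f = ρ n` (`IsForcedIncreasing.exists_isFibreJump_orbit`). In
`blowUp` each point `q` carries the coordinates `ρ n q`, except that the `n`-th is free at `p n`, so
`p n` becomes a segment. The map `f` lifts together with the shift of coordinates. Each `ρ n` jumps
from 0 to 1 on its fibre, so fibres of the blow-up are chains in the product order, and a weighted
sum of coordinates straightens it to `Θ × [0, 1]` (`exists_homeomorph_blowUp`).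

A continuous section of the preimage of Γ would give `ρ 0` a limit along Γ at `θ₀`. The fibre over
`θs` is not blown up, hence the preimage is pinched. Every nonempty closed forward invariant subset
contains that pinched point, so there is a least one, `M`. Equicontinuity of `α` makes this point
almost automorphic; if `M` were almost periodic it would be the graph of a continuous function
(`exists_minimalSet_almostAutomorphic`). -/

section Dynamics

/-! ### Almost periodic and minimal homeomorphisms. -/

variable {X : Type*}

theorem Homeomorph.zpow_add_apply [TopologicalSpace X] (g : X ≃ₜ X) (m n : ℤ) (x : X) :
    (g ^ (m + n)) x = (g ^ m) ((g ^ n) x) := by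
  rw [zpow_add, Homeomorph.mul_apply]

theorem Homeomorph.zpow_neg_apply_self [TopologicalSpace X] (g : X ≃ₜ X) (n : ℤ) (x : X) :
    (g ^ (-n)) ((g ^ n) x) = x := by
  rw [← g.zpow_add_apply, neg_add_cancel, zpow_zero]; rfl

theorem Homeomorph.zpow_apply_neg_self [TopologicalSpace X] (g : X ≃ₜ X) (n : ℤ) (x : X) :
    (g ^ n) ((g ^ (-n)) x) = x := by
  rw [← g.zpow_add_apply, add_neg_cancel, zpow_zero]; rfl

theorem Homeomorph.mapsTo_pow [TopologicalSpace X] {g : X ≃ₜ X} {S : Set X}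
    (h : Set.MapsTo g S S) (n : ℕ) : Set.MapsTo (g ^ (n : ℤ)) S S := by
  induction n with
  | zero => intro x hx; simpa using hx
  | succ k ih =>
    intro x hx
    rw [Nat.cast_succ, Homeomorph.zpow_add_apply, zpow_one]
    exact ih (h hx)

theorem Homeomorph.semiconj_zpow {Y : Type*} [TopologicalSpace X] [TopologicalSpace Y]
    {φ : X ≃ₜ X} {α : Y ≃ₜ Y} {π : X → Y} (h : ∀ x, π (φ x) = α (π x)) (n : ℤ) (x : X) :
    π ((φ ^ n) x) = (α ^ n) (π x) := by
  have hnat : ∀ (k : ℕ) x, π ((φ ^ (k : ℤ)) x) = (α ^ (k : ℤ)) (π x) := by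
    intro k
    induction k with
    | zero => intro x; simp
    | succ k ih =>
      intro x
      rw [Nat.cast_succ, Homeomorph.zpow_add_apply, zpow_one, ih, h,
        Homeomorph.zpow_add_apply, zpow_one]
  obtain ⟨k, rfl | rfl⟩ := n.eq_nat_or_neg
  · exact hnat k x
  · conv_rhs => rw [← φ.zpow_apply_neg_self k x, hnat, α.zpow_neg_apply_self]

theorem IsMinimalHomeo.zpow_injective [TopologicalSpace X] [T1Space X] [Infinite X] {g : X ≃ₜ X}
    (hg : IsMinimalHomeo g) (x : X) : Function.Injective fun n : ℤ => (g ^ n) x := by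
  have key : ∀ k : ℤ, k ≠ 0 → (g ^ k) x ≠ x := by
    intro k hk hx
    have hmul : ∀ j : ℤ, (g ^ (k * j)) x = x := by
      intro j
      induction j with
      | zero => simp
      | succ j ih => rw [mul_add, mul_one, g.zpow_add_apply, hx, ih]
      | pred j ih =>
        rw [mul_sub, mul_one, sub_eq_add_neg, g.zpow_add_apply]
        nth_rw 1 [← hx]
        rw [g.zpow_neg_apply_self, ih]
    have hfin : (Set.range fun n : ℤ => (g ^ n) x).Finite := by
      refine ((Set.finite_Ico 0 |k|).image fun n : ℤ => (g ^ n) x).subset ?_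
      rintro _ ⟨n, rfl⟩
      refine ⟨n % k, ⟨Int.emod_nonneg n hk, Int.emod_lt_abs n hk⟩, ?_⟩
      conv_rhs => rw [← Int.emod_add_mul_ediv n k]
      simp only [g.zpow_add_apply, hmul]
    have huniv := (hg x).closure_eq
    rw [hfin.isClosed.closure_eq] at huniv
    exact Set.infinite_univ (huniv ▸ hfin)
  intro m n hmn
  by_contra hne
  refine key (m - n) (sub_ne_zero.2 hne) ?_
  have : (g ^ (-n + m)) x = x := by
    rw [g.zpow_add_apply]
    simp only at hmn
    rw [hmn, g.zpow_neg_apply_self]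
  rwa [neg_add_eq_sub] at this

/-- Every power is a near-identity power composed with one of finitely many powers `g ^ j`, `0 ≤ j ≤
L`, which share a modulus of continuity. -/
theorem IsAlmostPeriodic.equicontinuous [MetricSpace X] [CompactSpace X] {g : X ≃ₜ X}
    (hg : IsAlmostPeriodic g) {ε : ℝ} (hε : 0 < ε) :
    ∃ δ > 0, ∀ (n : ℤ) (x y : X), dist x y < δ → dist ((g ^ n) x) ((g ^ n) y) < ε := by
  obtain ⟨L, hL⟩ := hg (ε / 3) (by positivity)
  have huc : ∀ j : ℤ, ∃ δ > 0, ∀ x y : X, dist x y < δ →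
      dist ((g ^ j) x) ((g ^ j) y) < ε / 3 := fun j => by
    obtain ⟨δ, hδ, h⟩ := Metric.uniformContinuous_iff.1
      (CompactSpace.uniformContinuous_of_continuous (g ^ j).continuous) (ε / 3) (by positivity)
    exact ⟨δ, hδ, @h⟩
  choose δ hδ hδ' using huc
  obtain ⟨j₀, -, hj₀⟩ := (Finset.Icc (0 : ℤ) L).exists_min_image δ ⟨0, by simp⟩
  refine ⟨δ j₀, hδ _, fun n x y hxy => ?_⟩
  obtain ⟨m, hm, h1, h2⟩ := hL (n - L)
  have hj : n - m ∈ Finset.Icc (0 : ℤ) L := by rw [Finset.mem_Icc]; omega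
  have e : n = m + (n - m) := by ring
  rw [e, g.zpow_add_apply, g.zpow_add_apply]
  have a1 := hm ((g ^ (n - m)) x)
  have a2 := hm ((g ^ (n - m)) y)
  have a3 := hδ' (n - m) x y (hxy.trans_le (hj₀ _ hj))
  calc _ ≤ _ + _ + _ := dist_triangle4 _ ((g ^ (n - m)) x) ((g ^ (n - m)) y) _
    _ < ε / 3 + ε / 3 + ε / 3 := by
      rw [dist_comm ((g ^ (n - m)) y)]
      gcongr
    _ = ε := by ring

/-- Forward invariance suffices: an almost period `m ≥ -n` approximates `(g ^ n) x` by the forward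
iterate `(g ^ (m + n)) x`. -/
theorem IsAlmostPeriodic.eq_univ_of_mapsTo [MetricSpace X] {g : X ≃ₜ X}
    (hg : IsAlmostPeriodic g) (hmin : IsMinimalHomeo g) {S : Set X} (hne : S.Nonempty)
    (hcl : IsClosed S) (hS : Set.MapsTo g S S) : S = Set.univ := by
  obtain ⟨x, hx⟩ := hne
  rw [Set.eq_univ_iff_forall]
  suffices h : Set.range (fun n : ℤ => (g ^ n) x) ⊆ S from
    fun y => hcl.closure_subset_iff.2 h (hmin x y)
  rintro _ ⟨n, rfl⟩
  rw [← hcl.closure_eq, Metric.mem_closure_iff]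
  intro ε hε
  obtain ⟨L, hL⟩ := hg ε hε
  obtain ⟨m, hm, h1, -⟩ := hL (-n)
  obtain ⟨k, hk⟩ := Int.eq_ofNat_of_zero_le (show 0 ≤ m + n by omega)
  refine ⟨(g ^ (m + n)) x, hk ▸ Homeomorph.mapsTo_pow hS k hx, ?_⟩
  rw [g.zpow_add_apply, dist_comm]
  exact hm _

theorem IsAlmostPeriodic.tendsto_zpow_neg [MetricSpace X] [CompactSpace X] {g : X ≃ₜ X}
    (hg : IsAlmostPeriodic g) {x y : X} {n : ℕ → ℤ}
    (h : Tendsto (fun k => (g ^ n k) x) atTop (𝓝 y)) :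
    Tendsto (fun k => (g ^ (-n k)) y) atTop (𝓝 x) := by
  rw [Metric.tendsto_nhds] at h ⊢
  intro ε hε
  obtain ⟨δ, hδ, H⟩ := hg.equicontinuous hε
  filter_upwards [h δ hδ] with k hk
  have := H (-n k) _ _ hk
  rwa [g.zpow_neg_apply_self, dist_comm] at this

/-- If the orbit of an accumulation point filled the space, Baire would make one of its points
isolated, hence all of them. -/
theorem exists_accPt_not_mem_orbit [MetricSpace X] [CompactSpace X] [Infinite X] (g : X ≃ₜ X) :
    ∃ x y : X, (𝓝[≠] x).NeBot ∧ ∀ n : ℤ, (g ^ n) x ≠ y := by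
  obtain ⟨x, hx⟩ : ∃ x : X, (𝓝[≠] x).NeBot := by
    by_contra! h
    have : DiscreteTopology X := discreteTopology_iff_isOpen_singleton.2 fun x =>
      isOpen_singleton_iff_punctured_nhds x |>.2 (h x)
    exact (finite_of_compact_of_discrete (X := X)).not_infinite inferInstance
  refine ⟨x, ?_⟩
  by_contra! h
  have : Nonempty X := ⟨x⟩
  obtain ⟨n, y, hy⟩ := nonempty_interior_of_iUnion_of_closed
    (f := fun n : ℤ => ({(g ^ n) x} : Set X)) (fun n => isClosed_singleton) (by
      rw [Set.eq_univ_iff_forall]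
      intro y
      obtain ⟨n, hn⟩ := h y hx
      exact Set.mem_iUnion.2 ⟨n, hn.symm⟩)
  have hopen : IsOpen ({(g ^ n) x} : Set X) := by
    have hyx : y ∈ ({(g ^ n) x} : Set X) := interior_subset hy
    rw [Set.mem_singleton_iff] at hyx
    subst hyx
    exact isOpen_iff_mem_nhds.2 fun z hz => by
      rw [Set.mem_singleton_iff.1 hz]; exact mem_interior_iff_mem_nhds.1 hy
  have hx' : IsOpen ({x} : Set X) := by
    convert hopen.preimage (g ^ n).continuous using 1
    ext z
    simp
  exact hx.ne ((isOpen_singleton_iff_punctured_nhds x).1 hx')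

end Dynamics

/-! ### The minimal set inside a pinched invariant compact set. -/

section MinimalSet

variable {Θ : Type*}

theorem IsForcedIncreasing.injective [TopologicalSpace Θ] {α : Θ ≃ₜ Θ} {g : Θ × unitInterval → Θ × unitInterval}
    (hg : IsForcedIncreasing α g) : Function.Injective g := by
  rintro ⟨θ, x⟩ ⟨θ', x'⟩ h
  have h1 : θ = θ' := α.injective (by
    rw [← hg.fst_eq (θ, x), ← hg.fst_eq (θ', x'), h])
  subst h1
  rw [(hg.strictMono θ).injective (congrArg Prod.snd h)]

variable [MetricSpace Θ] [CompactSpace Θ]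

/-- If a compact set has exactly one point in a fibre, points of the set whose base points
converge to that of the fibre converge to this point. -/
theorem comap_fst_inf_principal_le {K : Set (Θ × unitInterval)} (hK : IsClosed K) {θ : Θ}
    {z : unitInterval} (hz : ∀ x, (θ, x) ∈ K → x = z) :
    comap Prod.fst (𝓝 θ) ⊓ 𝓟 K ≤ 𝓝 ((θ, z) : Θ × unitInterval) := by
  refine isCompact_univ.le_nhds_of_unique_clusterPt (by simp) ?_
  rintro ⟨θ', x⟩ - hc
  have h1 : (θ', x) ∈ K := isClosed_iff_clusterPt.1 hK _ (hc.mono inf_le_right)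
  have h2 : ClusterPt θ' (𝓝 θ) := by
    have := (hc.mono inf_le_left).map (f := Prod.fst) continuous_fst.continuousAt
      (tendsto_map (f := Prod.fst))
    exact this.mono (map_comap_le)
  have h3 : θ' = θ := by
    by_contra hne
    exact (disjoint_nhds_nhds.2 hne).eq_bot |> h2.neBot.ne
  subst h3
  rw [hz x h1]

theorem exists_minimalSet_almostAutomorphic {α : Θ ≃ₜ Θ} (hap : IsAlmostPeriodic α)
    (hmin : IsMinimalHomeo α) {g : Θ × unitInterval → Θ × unitInterval}
    (hg : IsForcedIncreasing α g) {K : Set (Θ × unitInterval)} (hK : IsClosed K)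
    (hgK : Set.MapsTo g K K) {θs : Θ} {zs : unitInterval} (hzK : (θs, zs) ∈ K)
    (hz : ∀ x, (θs, x) ∈ K → x = zs)
    (hη : ¬ ∃ η : Θ → unitInterval, Continuous η ∧ curveGraph η ⊆ K) :
    ∃ M ⊆ K, IsMinimalSet g M ∧ IsAlmostAutomorphicOn g M ∧ ¬ IsAlmostPeriodicOn g M := by
  have hproj : ∀ L ⊆ K, L.Nonempty → IsClosed L → Set.MapsTo g L L → Prod.fst '' L = Set.univ := by
    intro L _ hne hcl hL
    refine hap.eq_univ_of_mapsTo hmin (hne.image _) (hcl.isCompact.image continuous_fst).isClosed ?_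
    rintro _ ⟨p, hp, rfl⟩
    exact ⟨g p, hL hp, hg.fst_eq p⟩
  have hmem : ∀ L ⊆ K, L.Nonempty → IsClosed L → Set.MapsTo g L L → (θs, zs) ∈ L := by
    intro L hLK hne hcl hL
    obtain ⟨⟨θ, x⟩, hp, rfl⟩ := (hproj L hLK hne hcl hL).symm ▸ Set.mem_univ θs
    rwa [← hz x (hLK hp)]
  -- All competitors share `(θs, zs)`, so their intersection is nonempty and Zorn's lemma is not
  -- needed.
  let M : Set (Θ × unitInterval) :=
    ⋂₀ {L | L ⊆ K ∧ L.Nonempty ∧ IsClosed L ∧ Set.MapsTo g L L}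
  have hMK : M ⊆ K := Set.sInter_subset_of_mem ⟨subset_rfl, ⟨_, hzK⟩, hK, hgK⟩
  have hzM : (θs, zs) ∈ M := fun L hL => hmem L hL.1 hL.2.1 hL.2.2.1 hL.2.2.2
  have hMcl : IsClosed M := isClosed_sInter fun L hL => hL.2.2.1
  have hgM : Set.MapsTo g M M := fun p hp L hL => hL.2.2.2 (hp L hL)
  have hMmin : ∀ L ⊆ M, L.Nonempty → IsClosed L → Set.MapsTo g L L → L = M :=
    fun L hLM hne hcl hL => hLM.antisymm
      (Set.sInter_subset_of_mem ⟨hLM.trans hMK, hne, hcl, hL⟩)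
  have hMinv : g '' M = M := hMmin _ hgM.image_subset (Set.Nonempty.image _ ⟨_, hzM⟩)
    (hMcl.isCompact.image hg.continuous).isClosed fun p hp =>
      ⟨p, hgM.image_subset hp, rfl⟩
  have hlim : ∀ (l : Filter ℕ) (u : ℕ → M), Tendsto (fun k => (u k : Θ × unitInterval).1) l (𝓝 θs) →
      Tendsto u l (𝓝 ⟨(θs, zs), hzM⟩) := fun l u hu => by
    rw [tendsto_subtype_rng]
    refine Tendsto.mono_right (tendsto_inf.2 ⟨tendsto_comap_iff.2 hu, ?_⟩)
      (comap_fst_inf_principal_le hK hz)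
    exact tendsto_principal.2 (Eventually.of_forall fun k => hMK (u k).2)
  have hMc : CompactSpace M := isCompact_iff_compactSpace.1 hMcl.isCompact
  refine ⟨M, hMK, ⟨⟨_, hzM⟩, hMcl, hMinv, hMmin⟩, ?_, ?_⟩
  · have hbij : Set.BijOn g M M := ⟨hgM, hg.injective.injOn, hMinv.ge⟩
    have hcont : Continuous (hbij.equiv g) :=
      (hg.continuous.comp continuous_subtype_val).subtype_mk fun p => hgM p.2
    let φ : M ≃ₜ M := hcont.homeoOfEquivCompactToT2
    have hφ : ∀ p : M, ((φ p : M) : Θ × unitInterval) = g p := fun p => rfl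
    refine ⟨φ, hφ, ⟨(θs, zs), hzM⟩, fun n y hy => hlim _ _ ?_⟩
    have hsemi := Homeomorph.semiconj_zpow (φ := φ) (α := α)
      (π := fun p : M => (p : Θ × unitInterval).1) (fun p => by rw [hφ, hg.fst_eq])
    simp only [hsemi]
    refine hap.tendsto_zpow_neg ?_
    have := ((continuous_fst.comp continuous_subtype_val).tendsto y).comp hy
    simpa only [Function.comp_def, hsemi] using this
  · rintro ⟨φ, hφ, hφap⟩
    have hsemi := Homeomorph.semiconj_zpow (φ := φ) (α := α)
      (π := fun p : M => (p : Θ × unitInterval).1) (fun p => by rw [hφ, hg.fst_eq])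
    -- Two points of one fibre, moved along the same times towards the fibre of `θs`, both tend to
    -- `(θs, zs)`; equicontinuity of the inverse powers forbids this unless they coincide.
    have hinj : Function.Injective fun p : M => (p : Θ × unitInterval).1 := by
      intro p q hpq
      by_contra hne
      obtain ⟨δ, hδ, H⟩ := hφap.equicontinuous (dist_pos.2 hne)
      obtain ⟨u, hu, hut⟩ := mem_closure_iff_seq_limit.1 (hmin (p : Θ × unitInterval).1 θs)
      choose n hn using hu
      have hp := hlim atTop (fun k => (φ ^ n k) p) (by simpa only [hsemi, hn] using hut)
      have hq := hlim atTop (fun k => (φ ^ n k) q) (by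
        simp only at hpq
        simpa only [hsemi, ← hpq, hn] using hut)
      have hd := hp.dist hq
      rw [dist_self] at hd
      obtain ⟨k, hk⟩ := (hd.eventually (gt_mem_nhds hδ)).exists
      have := H (-n k) _ _ hk
      rw [φ.zpow_neg_apply_self, φ.zpow_neg_apply_self] at this
      exact lt_irrefl _ this
    have hsurj : Function.Surjective fun p : M => (p : Θ × unitInterval).1 := fun θ => by
      obtain ⟨p, hp, rfl⟩ := (hproj M hMK ⟨_, hzM⟩ hMcl hgM).symm ▸ Set.mem_univ θ
      exact ⟨⟨p, hp⟩, rfl⟩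
    let e : M ≃ₜ Θ := Continuous.homeoOfEquivCompactToT2
      (f := Equiv.ofBijective _ ⟨hinj, hsurj⟩) (continuous_fst.comp continuous_subtype_val)
    refine hη ⟨fun θ => (e.symm θ : Θ × unitInterval).2,
      continuous_snd.comp (continuous_subtype_val.comp e.symm.continuous), ?_⟩
    rintro ⟨θ, x⟩ hx
    have h1 : (e.symm θ : Θ × unitInterval).1 = θ := e.apply_symm_apply θ
    have h2 : x = (e.symm θ : Θ × unitInterval).2 := hx
    have : (θ, x) = (e.symm θ : Θ × unitInterval) := Prod.ext h1.symm h2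
    rw [this]
    exact hMK (e.symm θ).2

end MinimalSet

/-! ### Blowing up a sequence of points in distinct fibres. -/

section BlowUp

variable {Θ : Type*}

/-- A function on `Θ × [0, 1]`, continuous off the point `p` and fibrewise monotone, which on the
fibre through `p` jumps from `0` to `1` at `p`. -/
structure IsFibreJump [TopologicalSpace Θ] (ρ : Θ × unitInterval → unitInterval)
    (p : Θ × unitInterval) : Prop where
  continuousAt : ∀ q, q ≠ p → ContinuousAt ρ q
  mono : ∀ θ y y', y ≤ y' → (θ, y) ≠ p → (θ, y') ≠ p → ρ (θ, y) ≤ ρ (θ, y')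
  zero : ∀ y, y < p.2 → ρ (p.1, y) = 0
  one : ∀ y, p.2 < y → ρ (p.1, y) = 1

/-- Meant for `T` a forced map or a left inverse of one. That `p'` is the sole preimage of `p` keeps
a single discontinuity and makes the weak inequalities strict off `p'`. -/
theorem IsFibreJump.comp [TopologicalSpace Θ] {ρ : Θ × unitInterval → unitInterval}
    {p p' : Θ × unitInterval} (h : IsFibreJump ρ p) {T : Θ × unitInterval → Θ × unitInterval}
    {β : Θ → Θ} (hT : Continuous T) (hβ : ∀ q, (T q).1 = β q.1)
    (hmono : ∀ θ, Monotone fun x => (T (θ, x)).2) (hp : ∀ q, T q = p ↔ q = p') :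
    IsFibreJump (ρ ∘ T) p' := by
  have hT' : ∀ θ x, T (θ, x) = (β θ, (T (θ, x)).2) := fun θ x => Prod.ext (hβ _) rfl
  have hpp : T p' = p := (hp p').2 rfl
  have hpβ : p.1 = β p'.1 := by rw [← hpp, hβ]
  have hne : ∀ y, y ≠ p'.2 → (T (p'.1, y)).2 ≠ p.2 := fun y hy h => by
    have : (p'.1, y) = p' := (hp _).1 (Prod.ext ((hβ _).trans hpβ.symm) h)
    exact hy (congrArg Prod.snd this)
  refine ⟨fun q hq => ?_, fun θ y y' hy h1 h2 => ?_, fun y hy => ?_, fun y hy => ?_⟩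
  · exact (h.continuousAt (T q) (mt (hp q).1 hq)).comp hT.continuousAt
  · have h1' := mt (hp _).1 h1
    have h2' := mt (hp _).1 h2
    have := hmono θ hy
    simp only [Function.comp_apply]
    rw [hT'] at h1' h2' ⊢
    rw [hT' θ y']
    exact h.mono _ _ _ this h1' h2'
  · have h1 : (T (p'.1, y)).2 ≤ p.2 := by
      have := hmono p'.1 hy.le
      simpa only [Prod.mk.eta, hpp] using this
    rw [Function.comp_apply, hT', ← hpβ]
    exact h.zero _ (h1.lt_of_ne (hne y hy.ne))
  · have h1 : p.2 ≤ (T (p'.1, y)).2 := by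
      have := hmono p'.1 hy.le
      simpa only [Prod.mk.eta, hpp] using this
    rw [Function.comp_apply, hT', ← hpβ]
    exact h.one _ (h1.lt_of_ne (hne y hy.ne').symm)

/-- The points `p n` are blown up to intervals: `u n` is determined by `ρ n` off `p n`. -/
def blowUp (ρ : ℤ → Θ × unitInterval → unitInterval) (p : ℤ → Θ × unitInterval) :
    Set ((Θ × unitInterval) × (ℤ → unitInterval)) :=
  {q | ∀ n, q.1 ≠ p n → q.2 n = ρ n q.1}

variable {ρ : ℤ → Θ × unitInterval → unitInterval} {p : ℤ → Θ × unitInterval}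

theorem isClosed_blowUp [TopologicalSpace Θ] [T1Space Θ] (hρ : ∀ n, IsFibreJump (ρ n) (p n)) :
    IsClosed (blowUp ρ p) := by
  have : blowUp ρ p = ⋂ n, {q | q.1 ≠ p n → q.2 n = ρ n q.1} := by
    ext q; simp [blowUp]
  rw [this]
  refine isClosed_iInter fun n => isClosed_iff_clusterPt.2 fun q hq hne => ?_
  have hopen : ∀ᶠ q' in 𝓝 q, q'.1 ≠ p n :=
    continuous_fst.continuousAt.eventually_ne hne
  set S := {q : (Θ × unitInterval) × (ℤ → unitInterval) | q.1 ≠ p n → q.2 n = ρ n q.1}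
  have : (𝓝 q ⊓ 𝓟 S).NeBot := hq
  have h1 : Tendsto (fun q' : (Θ × unitInterval) × (ℤ → unitInterval) => q'.2 n) (𝓝 q ⊓ 𝓟 S)
      (𝓝 (q.2 n)) :=
    ((continuous_apply n).comp continuous_snd).continuousAt.mono_left inf_le_left
  have h2 : Tendsto (fun q' : (Θ × unitInterval) × (ℤ → unitInterval) => ρ n q'.1) (𝓝 q ⊓ 𝓟 S)
      (𝓝 (ρ n q.1)) :=
    (ContinuousAt.comp (f := Prod.fst) ((hρ n).continuousAt _ hne)
      continuous_fst.continuousAt).mono_left inf_le_left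
  refine tendsto_nhds_unique (h1.congr' ?_) h2
  filter_upwards [inf_le_left (b := 𝓟 S) hopen, inf_le_right (a := 𝓝 q) (mem_principal_self S)]
    with q' h3 h4 using h4 h3

section Weight

/-- The unnormalised fibre coordinate on the blow-up. -/
noncomputable def blowUpWeight (q : unitInterval × (ℤ → unitInterval)) : ℝ :=
  q.1 + ∑' n, (1 / 2 : ℝ) ^ Encodable.encode n * (q.2 n : ℝ)

theorem norm_weight_term_le (u : ℤ → unitInterval) (n : ℤ) :
    ‖(1 / 2 : ℝ) ^ Encodable.encode n * (u n : ℝ)‖ ≤ (1 / 2 : ℝ) ^ Encodable.encode n := by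
  rw [norm_mul, Real.norm_of_nonneg (by positivity), Real.norm_of_nonneg (u n).2.1]
  exact mul_le_of_le_one_right (by positivity) (u n).2.2

theorem summable_weight (u : ℤ → unitInterval) :
    Summable fun n => (1 / 2 : ℝ) ^ Encodable.encode n * (u n : ℝ) :=
  Summable.of_norm_bounded summable_geometric_two_encode (norm_weight_term_le u)

theorem continuous_blowUpWeight : Continuous blowUpWeight := by
  refine (continuous_subtype_val.comp continuous_fst).add ?_
  refine continuous_tsum (fun n => ?_) (summable_geometric_two_encode (ι := ℤ))
    fun n q => norm_weight_term_le q.2 n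
  exact continuous_const.mul
    (continuous_subtype_val.comp ((continuous_apply n).comp continuous_snd))

theorem strictMono_blowUpWeight : StrictMono blowUpWeight := by
  have hle : ∀ u v : ℤ → unitInterval, u ≤ v → ∀ n,
      (1 / 2 : ℝ) ^ Encodable.encode n * (u n : ℝ) ≤ (1 / 2 : ℝ) ^ Encodable.encode n * (v n : ℝ) :=
    fun u v h n => mul_le_mul_of_nonneg_left (h n) (by positivity)
  rintro ⟨x, u⟩ ⟨y, v⟩ h
  rcases Prod.mk_lt_mk.1 h with ⟨h1, h2⟩ | ⟨h1, h2⟩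
  · exact add_lt_add_of_lt_of_le h1
      ((summable_weight u).tsum_le_tsum (hle u v h2) (summable_weight v))
  · obtain ⟨h3, n, hn⟩ := Pi.lt_def.1 h2
    exact add_lt_add_of_le_of_lt h1 ((summable_weight u).tsum_lt_tsum (hle u v h3)
      (mul_lt_mul_of_pos_left hn (by positivity)) (summable_weight v))

end Weight

/-- The jump of `ρ n` leaves room for the free value at `p n`: it lies between 0 below and 1 above.
Only two points over the same `p n` escape, which `hne` excludes. -/
theorem blowUp_snd_le [TopologicalSpace Θ] (hρ : ∀ n, IsFibreJump (ρ n) (p n)) {θ : Θ}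
    {y y' : unitInterval} {u u' : ℤ → unitInterval} (hu : ((θ, y), u) ∈ blowUp ρ p)
    (hu' : ((θ, y'), u') ∈ blowUp ρ p) (hy : y ≤ y')
    (hne : y = y' → ∀ n, (θ, y) ≠ p n) : u ≤ u' := by
  intro n
  by_cases h1 : (θ, y) = p n
  · have hlt : y < y' := hy.lt_of_ne fun h => hne h n h1
    have h2 : (θ, y') ≠ p n := fun h => hlt.ne (congrArg Prod.snd (h1.trans h.symm))
    rw [show u' n = ρ n (θ, y') from hu' n h2]
    have := (hρ n).one y' (by rwa [← h1])
    rw [← h1] at this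
    rw [this]
    exact unitInterval.le_one'
  · rw [show u n = ρ n (θ, y) from hu n h1]
    by_cases h2 : (θ, y') = p n
    · have hlt : y < y' := hy.lt_of_ne fun h => h1 (h ▸ h2)
      have := (hρ n).zero y (by rwa [← h2])
      rw [← h2] at this
      rw [this]
      exact unitInterval.nonneg'
    · rw [show u' n = ρ n (θ, y') from hu' n h2]
      exact (hρ n).mono θ y y' hy h1 h2

/-- Over a point of the plane at most one coordinate is free, since `p` is injective. Being a chain,
a fibre can be parametrised by a single strictly monotone real weight. -/
theorem blowUp_fibre_total [TopologicalSpace Θ] (hρ : ∀ n, IsFibreJump (ρ n) (p n))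
    (hp : Function.Injective p) {θ : Θ}
    {q q' : unitInterval × (ℤ → unitInterval)} (hq : ((θ, q.1), q.2) ∈ blowUp ρ p)
    (hq' : ((θ, q'.1), q'.2) ∈ blowUp ρ p) : q ≤ q' ∨ q' ≤ q := by
  obtain ⟨y, u⟩ := q
  obtain ⟨y', u'⟩ := q'
  rcases lt_trichotomy y y' with h | rfl | h
  · exact Or.inl ⟨h.le, blowUp_snd_le hρ hq hq' h.le fun h' => absurd h' h.ne⟩
  · by_cases hn : ∃ n, (θ, y) = p n
    · obtain ⟨n, hn⟩ := hn
      have hoff : ∀ m, m ≠ n → u m = u' m := fun m hm => by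
        have : (θ, y) ≠ p m := fun h => hm (hp (h.symm.trans hn))
        exact (hq m this).trans (hq' m this).symm
      refine (le_total (u n) (u' n)).imp (fun h => ⟨le_rfl, fun m => ?_⟩)
        fun h => ⟨le_rfl, fun m => ?_⟩
      · rcases eq_or_ne m n with rfl | hm
        exacts [h, (hoff m hm).le]
      · rcases eq_or_ne m n with rfl | hm
        exacts [h, (hoff m hm).ge]
    · push Not at hn
      exact Or.inl ⟨le_rfl, blowUp_snd_le hρ hq hq' le_rfl fun _ => hn⟩
  · exact Or.inr ⟨h.le, blowUp_snd_le hρ hq' hq h.le fun h' => absurd h' h.ne⟩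

/-- A fibre through `p n` is a path of three arcs: below `p n` with `n`-th coordinate 0, up the
segment over `p n`, then above with coordinate 1. The intermediate value theorem applies on each. -/
theorem exists_blowUpWeight_eq [TopologicalSpace Θ] (hρ : ∀ n, IsFibreJump (ρ n) (p n))
    (hp : Function.Injective fun n => (p n).1) {θ : Θ} {w : ℝ}
    (hp0 : ∀ n, (p n).2 ≠ 0) (hp1 : ∀ n, (p n).2 ≠ 1)
    (h0 : blowUpWeight (0, fun n => ρ n (θ, 0)) ≤ w)
    (h1 : w ≤ blowUpWeight (1, fun n => ρ n (θ, 1))) :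
    ∃ q : unitInterval × (ℤ → unitInterval),
      ((θ, q.1), q.2) ∈ blowUp ρ p ∧ blowUpWeight q = w := by
  have hcont : ∀ n, θ ≠ (p n).1 → Continuous fun y => ρ n (θ, y) := fun n hn =>
    continuous_iff_continuousAt.2 fun y =>
      ContinuousAt.comp (f := fun y => (θ, y))
        ((hρ n).continuousAt (θ, y) fun h => hn (congrArg Prod.fst h)) (by fun_prop)
  by_cases hθ : ∃ n, θ = (p n).1
  · obtain ⟨n, rfl⟩ := hθ
    let E : unitInterval × unitInterval → unitInterval × (ℤ → unitInterval) := fun z =>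
      (z.1, Function.update (fun m => ρ m ((p n).1, z.1)) n z.2)
    have hE : Continuous E := by
      refine continuous_fst.prodMk (continuous_pi fun m => ?_)
      rcases eq_or_ne m n with rfl | hm
      · simpa using continuous_snd
      · simp only [Function.update_of_ne hm]
        exact (hcont m fun h => hm (hp h.symm)).comp continuous_fst
    have hmem : ∀ y c, (((p n).1, y) ≠ p n → c = ρ n ((p n).1, y)) →
        (((p n).1, (E (y, c)).1), (E (y, c)).2) ∈ blowUp ρ p := by
      intro y c hc m hm
      rcases eq_or_ne m n with rfl | hmn
      · simpa [E] using hc hm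
      · simp [E, Function.update_of_ne hmn]
    have hWE := continuous_blowUpWeight.comp hE
    have e0 : E (0, 0) = (0, fun m => ρ m ((p n).1, 0)) := by
      refine Prod.ext rfl ?_
      simp only [E, Function.update_eq_self_iff]
      exact ((hρ n).zero 0 (unitInterval.pos_iff_ne_zero.2 (hp0 n))).symm
    have e1 : E (1, 1) = (1, fun m => ρ m ((p n).1, 1)) := by
      refine Prod.ext rfl ?_
      simp only [E, Function.update_eq_self_iff]
      exact ((hρ n).one 1 (unitInterval.lt_one_iff_ne_one.2 (hp1 n))).symm
    rw [← e0] at h0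
    rw [← e1] at h1
    rcases le_total w (blowUpWeight (E ((p n).2, 0))) with ha | ha
    · obtain ⟨y, hy, rfl⟩ := intermediate_value_Icc (f := fun y => blowUpWeight (E (y, 0)))
        (unitInterval.nonneg' (t := (p n).2)) (hWE.comp (by fun_prop)).continuousOn ⟨h0, ha⟩
      refine ⟨_, hmem y 0 fun h => ?_, rfl⟩
      exact ((hρ n).zero y (hy.2.lt_of_ne fun h' => h (Prod.ext rfl h'))).symm
    rcases le_total w (blowUpWeight (E ((p n).2, 1))) with hb | hb
    · obtain ⟨c, -, rfl⟩ := intermediate_value_Icc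
        (f := fun c => blowUpWeight (E ((p n).2, c))) (zero_le_one (α := unitInterval))
        (hWE.comp (by fun_prop)).continuousOn ⟨ha, hb⟩
      exact ⟨_, hmem _ c fun h => absurd rfl h, rfl⟩
    · obtain ⟨y, hy, rfl⟩ := intermediate_value_Icc (f := fun y => blowUpWeight (E (y, 1)))
        (unitInterval.le_one' (t := (p n).2)) (hWE.comp (by fun_prop)).continuousOn ⟨hb, h1⟩
      refine ⟨_, hmem y 1 fun h => ?_, rfl⟩
      exact ((hρ n).one y (hy.1.lt_of_ne fun h' => h (Prod.ext rfl h'.symm))).symm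
  · push Not at hθ
    have hc : Continuous fun y : unitInterval => blowUpWeight (y, fun n => ρ n (θ, y)) :=
      continuous_blowUpWeight.comp
        (continuous_id.prodMk (continuous_pi fun n => hcont n (hθ n)))
    obtain ⟨y, -, rfl⟩ := intermediate_value_Icc (zero_le_one (α := unitInterval))
      hc.continuousOn ⟨h0, h1⟩
    exact ⟨_, fun n _ => rfl, rfl⟩

/-- The blow-up is again `Θ × [0, 1]`, by a fibrewise order isomorphism. -/
theorem exists_homeomorph_blowUp [TopologicalSpace Θ] [CompactSpace Θ] [T2Space Θ]
    (hρ : ∀ n, IsFibreJump (ρ n) (p n)) (hp : Function.Injective fun n => (p n).1)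
    (hp0 : ∀ n, (p n).2 ≠ 0) (hp1 : ∀ n, (p n).2 ≠ 1) :
    ∃ Ψ : blowUp ρ p ≃ₜ Θ × unitInterval, (∀ q, (Ψ q).1 = q.1.1.1) ∧
      ∀ q q' : blowUp ρ p, q.1.1.1 = q'.1.1.1 →
        ((Ψ q).2 ≤ (Ψ q').2 ↔ q.1.1.2 ≤ q'.1.1.2 ∧ q.1.2 ≤ q'.1.2) := by
  have hp' : Function.Injective p := fun m n h => hp (congrArg Prod.fst h)
  let A : Θ → ℝ := fun θ => blowUpWeight (0, fun n => ρ n (θ, 0))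
  let B : Θ → ℝ := fun θ => blowUpWeight (1, fun n => ρ n (θ, 1))
  -- No `p n` lies on the bottom or top edge, so the extreme weights vary continuously with the
  -- fibre.
  have hconst : ∀ c : unitInterval, (∀ n, (p n).2 ≠ c) →
      Continuous fun θ => blowUpWeight (c, fun n => ρ n (θ, c)) := fun c hc =>
    continuous_blowUpWeight.comp (continuous_const.prodMk (continuous_pi fun n =>
      continuous_iff_continuousAt.2 fun θ => ContinuousAt.comp (f := fun θ => (θ, c))
        ((hρ n).continuousAt (θ, c) fun h => hc n (congrArg Prod.snd h).symm) (by fun_prop)))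
  have hA : Continuous A := hconst 0 hp0
  have hB : Continuous B := hconst 1 hp1
  let W : blowUp ρ p → ℝ := fun q => blowUpWeight (q.1.1.2, q.1.2)
  have hW : Continuous W := continuous_blowUpWeight.comp (by fun_prop)
  have hAW : ∀ q : blowUp ρ p, A q.1.1.1 ≤ W q := fun q =>
    strictMono_blowUpWeight.monotone ⟨unitInterval.nonneg',
      blowUp_snd_le hρ (θ := q.1.1.1) (fun n _ => rfl) q.2 unitInterval.nonneg'
        fun _ n h => hp0 n (congrArg Prod.snd h).symm⟩
  have hWB : ∀ q : blowUp ρ p, W q ≤ B q.1.1.1 := fun q =>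
    strictMono_blowUpWeight.monotone ⟨unitInterval.le_one',
      blowUp_snd_le hρ (θ := q.1.1.1) (y' := 1) q.2 (fun n _ => rfl) unitInterval.le_one'
        fun h n h' => hp1 n (by rw [← h', h])⟩
  have hAB : ∀ θ, 0 < B θ - A θ := fun θ => sub_pos.2 <| strictMono_blowUpWeight <|
    Prod.mk_lt_mk.2 <| Or.inl ⟨zero_lt_one, blowUp_snd_le hρ (θ := θ) (y := 0) (y' := 1)
      (fun n _ => rfl) (fun n _ => rfl) zero_le_one fun h => absurd h zero_ne_one⟩
  have hWle : ∀ q q' : blowUp ρ p, q.1.1.1 = q'.1.1.1 →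
      (W q ≤ W q' ↔ q.1.1.2 ≤ q'.1.1.2 ∧ q.1.2 ≤ q'.1.2) := by
    intro q q' h
    have hq : ((q'.1.1.1, q.1.1.2), q.1.2) ∈ blowUp ρ p := by rw [← h]; exact q.2
    constructor
    · intro hle
      rcases blowUp_fibre_total hρ hp' (q := (q.1.1.2, q.1.2)) (q' := (q'.1.1.2, q'.1.2))
        hq q'.2 with h1 | h1
      · exact h1
      · have : W q = W q' := hle.antisymm (strictMono_blowUpWeight.monotone h1)
        rcases h1.eq_or_lt with h2 | h2
        · exact h2.ge
        · exact absurd (strictMono_blowUpWeight h2) this.not_gt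
    · exact fun hle => strictMono_blowUpWeight.monotone hle
  let N : blowUp ρ p → unitInterval := fun q =>
    ⟨(W q - A q.1.1.1) / (B q.1.1.1 - A q.1.1.1), div_nonneg (sub_nonneg.2 (hAW q)) (hAB _).le,
      (div_le_one (hAB _)).2 (sub_le_sub_right (hWB q) _)⟩
  have hN : Continuous N := Continuous.subtype_mk (Continuous.div (by fun_prop) (by fun_prop)
    fun q => (hAB _).ne') _
  have hNle : ∀ q q' : blowUp ρ p, q.1.1.1 = q'.1.1.1 →
      (N q ≤ N q' ↔ q.1.1.2 ≤ q'.1.1.2 ∧ q.1.2 ≤ q'.1.2) := by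
    intro q q' h
    rw [← hWle q q' h]
    change (W q - A q.1.1.1) / (B q.1.1.1 - A q.1.1.1)
      ≤ (W q' - A q'.1.1.1) / (B q'.1.1.1 - A q'.1.1.1) ↔ _
    rw [h, div_le_div_iff_of_pos_right (hAB _), sub_le_sub_iff_right]
  have hbij : Function.Bijective fun q : blowUp ρ p => (q.1.1.1, N q) := by
    constructor
    · intro q q' h
      have h1 : q.1.1.1 = q'.1.1.1 := (Prod.mk.inj h).1
      have h2 : N q = N q' := (Prod.mk.inj h).2
      have h3 := (hNle q q' h1).1 h2.le
      have h4 := (hNle q' q h1.symm).1 h2.ge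
      exact Subtype.ext (Prod.ext (Prod.ext h1 (h3.1.antisymm h4.1)) (h3.2.antisymm h4.2))
    · rintro ⟨θ, t⟩
      obtain ⟨q, hq, hqW⟩ := exists_blowUpWeight_eq hρ hp (θ := θ)
        (w := A θ + t * (B θ - A θ)) hp0 hp1
        (le_add_of_nonneg_right (mul_nonneg t.2.1 (hAB θ).le))
        (by
          change _ ≤ B θ
          have := mul_le_of_le_one_left (hAB θ).le t.2.2
          linarith)
      refine ⟨⟨((θ, q.1), q.2), hq⟩, Prod.ext rfl (Subtype.ext ?_)⟩
      change (blowUpWeight q - A θ) / (B θ - A θ) = t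
      rw [hqW, add_sub_cancel_left, mul_div_assoc, div_self (hAB θ).ne', mul_one]
  have hXc : CompactSpace (blowUp ρ p) :=
    isCompact_iff_compactSpace.1 (isClosed_blowUp hρ).isCompact
  have hc : Continuous (Equiv.ofBijective _ hbij) :=
    (continuous_fst.comp (continuous_fst.comp continuous_subtype_val)).prodMk hN
  exact ⟨hc.homeoOfEquivCompactToT2, fun q => rfl, hNle⟩

end BlowUp

/-! ### Constructing fibre jumps and transporting them along an orbit. -/

section Jumps

variable {Θ : Type*}

theorem exists_injective_seq_tendsto [MetricSpace Θ] (θ₀ : Θ) [(𝓝[≠] θ₀).NeBot] :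
    ∃ x : ℕ → Θ, Function.Injective x ∧ (∀ k, x k ≠ θ₀) ∧ Tendsto x atTop (𝓝 θ₀) := by
  obtain ⟨x, hx⟩ := exists_seq_tendsto (𝓝[≠] θ₀)
  obtain ⟨hx1, hx2⟩ := tendsto_nhdsWithin_iff.1 hx
  have hd : Tendsto (fun k => (dist (x k) θ₀)⁻¹) atTop atTop := by
    refine Tendsto.inv_tendsto_nhdsGT_zero (tendsto_nhdsWithin_iff.2 ⟨?_, ?_⟩)
    · exact tendsto_iff_dist_tendsto_zero.1 hx1
    · filter_upwards [hx2] with k hk using dist_pos.2 hk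
  obtain ⟨N, hN⟩ := eventually_atTop.1 hx2
  have hshift : Tendsto (fun k => k + N) atTop atTop := tendsto_add_atTop_nat N
  obtain ⟨φ, hφ, hφd⟩ := strictMono_subseq_of_tendsto_atTop (hd.comp hshift)
  refine ⟨fun k => x (φ k + N), fun i j hij => hφd.injective ?_, fun k => hN _ (by omega),
    hx1.comp (hshift.comp hφ.tendsto_atTop)⟩
  simp only at hij
  simp only [Function.comp_apply, hij]

/-- The even and the odd terms of an injective sequence tending to `θ₀`, each with its limit added.
-/
theorem exists_isClosed_inter_eq_singleton [MetricSpace Θ] (θ₀ : Θ) [(𝓝[≠] θ₀).NeBot] :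
    ∃ A B : Set Θ, IsClosed A ∧ IsClosed B ∧ A ∩ B = {θ₀} ∧
      (∃ᶠ θ in 𝓝[≠] θ₀, θ ∈ A) ∧ ∃ᶠ θ in 𝓝[≠] θ₀, θ ∈ B := by
  obtain ⟨x, hinj, hne, hlim⟩ := exists_injective_seq_tendsto θ₀
  have hwithin : Tendsto x atTop (𝓝[≠] θ₀) :=
    tendsto_nhdsWithin_iff.2 ⟨hlim, Eventually.of_forall hne⟩
  have h0 : Tendsto (fun k : ℕ => 2 * k) atTop atTop :=
    tendsto_atTop_mono (fun k => by simp only [id]; omega) tendsto_id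
  have h1 : Tendsto (fun k : ℕ => 2 * k + 1) atTop atTop :=
    tendsto_atTop_mono (fun k => by simp only [id]; omega) tendsto_id
  refine ⟨insert θ₀ (Set.range (x ∘ fun k => 2 * k)), insert θ₀ (Set.range (x ∘ fun k => 2 * k + 1)),
    (hlim.comp h0).isCompact_insert_range.isClosed, (hlim.comp h1).isCompact_insert_range.isClosed,
    ?_, ?_, ?_⟩
  · refine Set.Subset.antisymm ?_ (by simp)
    rintro θ ⟨rfl | ⟨i, rfl⟩, hB⟩
    · rfl
    · rcases hB with h | ⟨j, hj⟩
      · exact h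
      · have : 2 * j + 1 = 2 * i := hinj hj
        omega
  · exact (hwithin.comp h0).frequently (Frequently.of_forall fun k => Or.inr ⟨k, rfl⟩)
  · exact (hwithin.comp h1).frequently (Frequently.of_forall fun k => Or.inr ⟨k, rfl⟩)

/-- There is a fibre jump at a point of a continuous curve which oscillates along the curve. -/
theorem exists_isFibreJump_not_tendsto [MetricSpace Θ] {γ : Θ → unitInterval} (hγ : Continuous γ)
    (θ₀ : Θ) [(𝓝[≠] θ₀).NeBot] :
    ∃ ρ : Θ × unitInterval → unitInterval, IsFibreJump ρ (θ₀, γ θ₀) ∧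
      ∀ c, ¬ Tendsto (fun θ => ρ (θ, γ θ)) (𝓝[≠] θ₀) (𝓝 c) := by
  obtain ⟨A, B, hA, hB, hAB, hfA, hfB⟩ := exists_isClosed_inter_eq_singleton θ₀
  have hA0 : θ₀ ∈ A := (hAB.symm ▸ Set.mem_singleton θ₀ : θ₀ ∈ A ∩ B).1
  have hB0 : θ₀ ∈ B := (hAB.symm ▸ Set.mem_singleton θ₀ : θ₀ ∈ A ∩ B).2
  -- `P` vanishes over `A` on and below the curve, `Q` over `B` on and above it; the only common
  -- zero is `(θ₀, γ θ₀)`. Along the curve `P / (P + Q)` is therefore 0 over `A` and 1 over `B`,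
  -- away from `θ₀`.
  let P : Θ × unitInterval → ℝ := fun q => Metric.infDist q.1 A + max ((q.2 : ℝ) - γ q.1) 0
  let Q : Θ × unitInterval → ℝ := fun q => Metric.infDist q.1 B + max ((γ q.1 : ℝ) - q.2) 0
  have hPc : Continuous P := ((Metric.continuous_infDist_pt A).comp continuous_fst).add
    (by fun_prop)
  have hQc : Continuous Q := ((Metric.continuous_infDist_pt B).comp continuous_fst).add
    (by fun_prop)
  have hP : ∀ q, 0 ≤ P q := fun q => add_nonneg Metric.infDist_nonneg (le_max_right _ _)
  have hQ : ∀ q, 0 ≤ Q q := fun q => add_nonneg Metric.infDist_nonneg (le_max_right _ _)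
  have hzero : ∀ q, P q = 0 → Q q = 0 → q = (θ₀, γ θ₀) := by
    rintro ⟨θ, y⟩ h1 h2
    obtain ⟨h3, h4⟩ := (add_eq_zero_iff_of_nonneg Metric.infDist_nonneg (le_max_right _ _)).1 h1
    obtain ⟨h5, h6⟩ := (add_eq_zero_iff_of_nonneg Metric.infDist_nonneg (le_max_right _ _)).1 h2
    have h7 : θ ∈ A ∩ B := ⟨(hA.mem_iff_infDist_zero ⟨_, hA0⟩).2 h3,
      (hB.mem_iff_infDist_zero ⟨_, hB0⟩).2 h5⟩
    rw [hAB] at h7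
    obtain rfl : θ = θ₀ := h7
    have h8 := max_eq_right_iff.1 h4
    have h9 := max_eq_right_iff.1 h6
    exact Prod.ext rfl (Subtype.ext (by simp only at h8 h9 ⊢; linarith))
  have hpos : ∀ q, q ≠ (θ₀, γ θ₀) → 0 < P q + Q q := fun q hq =>
    (add_nonneg (hP q) (hQ q)).lt_of_ne fun h => hq <| by
      obtain ⟨h1, h2⟩ := (add_eq_zero_iff_of_nonneg (hP q) (hQ q)).1 h.symm
      exact hzero q h1 h2
  -- At the jump point this is `0 / 0 = 0`, a value that `IsFibreJump` ignores.
  let ρ : Θ × unitInterval → unitInterval := fun q =>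
    ⟨P q / (P q + Q q), div_nonneg (hP q) (add_nonneg (hP q) (hQ q)),
      div_le_one_of_le₀ (le_add_of_nonneg_right (hQ q)) (add_nonneg (hP q) (hQ q))⟩
  have hρ0 : ∀ q, P q = 0 → ρ q = 0 := fun q hq => Subtype.ext (by simp [ρ, hq])
  have hρ1 : ∀ q, q ≠ (θ₀, γ θ₀) → Q q = 0 → ρ q = 1 := fun q hq hQq => Subtype.ext (by
    have := hpos q hq
    rw [hQq, add_zero] at this
    simp [ρ, hQq, this.ne'])
  refine ⟨ρ, ⟨fun q hq => ?_, fun θ y y' hy h1 h2 => ?_, fun y hy => ?_, fun y hy => ?_⟩,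
    fun c hc => ?_⟩
  · exact tendsto_subtype_rng.2
      (hPc.continuousAt.div (hPc.add hQc).continuousAt (hpos q hq).ne')
  · have hPP : P (θ, y) ≤ P (θ, y') :=
      add_le_add_right (max_le_max_right 0 (sub_le_sub_right (Subtype.coe_le_coe.2 hy) _)) _
    have hQQ : Q (θ, y') ≤ Q (θ, y) :=
      add_le_add_right (max_le_max_right 0 (sub_le_sub_left (Subtype.coe_le_coe.2 hy) _)) _
    refine Subtype.coe_le_coe.1 ((div_le_div_iff₀ (hpos _ h1) (hpos _ h2)).2 ?_)
    have := mul_le_mul hPP hQQ (hQ _) (hP _)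
    linarith
  · refine hρ0 _ ?_
    have : ((y : ℝ) - γ θ₀) ≤ 0 := sub_nonpos.2 (Subtype.coe_le_coe.2 hy.le)
    simp only [P, Metric.infDist_zero_of_mem hA0, max_eq_right this, add_zero]
  · refine hρ1 _ (fun h => hy.ne (congrArg Prod.snd h).symm) ?_
    have : ((γ θ₀ : ℝ) - y) ≤ 0 := sub_nonpos.2 (Subtype.coe_le_coe.2 hy.le)
    simp only [Q, Metric.infDist_zero_of_mem hB0, max_eq_right this, add_zero]
  · have hcl : ∀ d : unitInterval, (∃ᶠ θ in 𝓝[≠] θ₀, ρ (θ, γ θ) = d) → c = d := fun d hd => by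
      by_contra hne
      exact hd (hc.eventually_ne hne)
    have hc0 : c = 0 := hcl 0 (hfA.mono fun θ hθ =>
      hρ0 _ (by simp [P, Metric.infDist_zero_of_mem hθ]))
    have hc1 : c = 1 := hcl 1 ((hfB.and_eventually self_mem_nhdsWithin).mono fun θ hθ =>
      hρ1 _ (fun h => hθ.2 (congrArg Prod.fst h)) (by simp [Q, Metric.infDist_zero_of_mem hθ.1]))
    exact zero_ne_one (hc0.symm.trans hc1)

/-- Fibre maps need not be onto, so `R` first clamps to the range of `f` and then inverts. Clamping
identifies points only with images of the endpoints 0 and 1, hence an interior `p` has no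
`R`-preimage but `f p`. -/
theorem IsForcedIncreasing.exists_leftInverse [TopologicalSpace Θ] [CompactSpace Θ] [T2Space Θ]
    {α : Θ ≃ₜ Θ} {f : Θ × unitInterval → Θ × unitInterval} (hf : IsForcedIncreasing α f) :
    ∃ R : Θ × unitInterval → Θ × unitInterval, Continuous R ∧ Function.LeftInverse R f ∧
      (∀ q, (R q).1 = α.symm q.1) ∧ (∀ θ, Monotone fun x => (R (θ, x)).2) ∧
      ∀ p q, 0 < p.2 → p.2 < 1 → R q = p → q = f p := by
  let c : Θ × unitInterval → Θ × unitInterval := fun q =>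
    (q.1, max (f (α.symm q.1, 0)).2 (min q.2 (f (α.symm q.1, 1)).2))
  have hfc := hf.continuous
  have hcc : Continuous c := by fun_prop
  have hfθ : ∀ θ x, f (θ, x) = (α θ, (f (θ, x)).2) := fun θ x => Prod.ext (hf.fst_eq _) rfl
  have hcr : ∀ q, c q ∈ Set.range f := fun q => by
    have h01 := (hf.strictMono (α.symm q.1)).monotone (zero_le_one (α := unitInterval))
    obtain ⟨x, -, hx⟩ := intermediate_value_Icc (f := fun x => (f (α.symm q.1, x)).2)
      (zero_le_one (α := unitInterval)) (by fun_prop)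
      (show (c q).2 ∈ _ from ⟨le_max_left _ _, max_le h01 (min_le_right _ _)⟩)
    exact ⟨(α.symm q.1, x), Prod.ext ((hf.fst_eq _).trans (α.apply_symm_apply _)) hx⟩
  let φ := (hfc.isClosedEmbedding hf.injective).isEmbedding.toHomeomorph
  let R : Θ × unitInterval → Θ × unitInterval := fun q => φ.symm ⟨c q, hcr q⟩
  have hfR : ∀ q, f (R q) = c q := fun q =>
    congrArg Subtype.val (φ.apply_symm_apply ⟨c q, hcr q⟩)
  have hcf : ∀ q, c (f q) = f q := fun q => by
    have h0 := (hf.strictMono q.1).monotone (unitInterval.nonneg' (t := q.2))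
    have h1 := (hf.strictMono q.1).monotone (unitInterval.le_one' (t := q.2))
    simp only [Prod.mk.eta] at h0 h1
    refine Prod.ext rfl ?_
    simp only [c, hf.fst_eq, α.symm_apply_apply, min_eq_left h1, max_eq_right h0]
  have hR1 : ∀ q, (R q).1 = α.symm q.1 := fun q => by
    rw [α.eq_symm_apply, ← hf.fst_eq, hfR]
  refine ⟨R, φ.symm.continuous.comp (hcc.subtype_mk _), fun q => hf.injective (by rw [hfR, hcf]),
    hR1, fun θ x x' hx => ?_, fun p q hp0 hp1 hq => ?_⟩
  · refine (hf.strictMono (α.symm θ)).le_iff_le.1 ?_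
    have e : ∀ x, (α.symm θ, (R (θ, x)).2) = R (θ, x) := fun x => Prod.ext (hR1 (θ, x)).symm rfl
    simp only [e, hfR]
    exact max_le_max_left _ (min_le_min_right _ hx)
  · have h1 : c q = f p := by rw [← hq, hfR]
    have h2 : q.1 = α p.1 := by
      rw [← hf.fst_eq p, ← h1]
    have h3 : (c q).2 = (f p).2 := congrArg Prod.snd h1
    have h4 := hf.strictMono p.1 hp0
    have h5 := hf.strictMono p.1 hp1
    simp only [Prod.mk.eta] at h4 h5
    simp only [c, h2, α.symm_apply_apply] at h3
    refine Prod.ext (h2.trans (hf.fst_eq p).symm) ?_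
    rcases max_cases (f (p.1, 0)).2 (min q.2 (f (p.1, 1)).2) with h | h
    · rw [h.1] at h3
      exact absurd h3 h4.ne
    · rw [h.1] at h3
      rcases min_cases q.2 (f (p.1, 1)).2 with h' | h'
      · rwa [h'.1] at h3
      · rw [h'.1] at h3
        exact absurd h3 h5.ne'

/-- A fibre jump can be transported along an orbit of a forced increasing interval map. -/
theorem IsForcedIncreasing.exists_isFibreJump_orbit [TopologicalSpace Θ] [CompactSpace Θ]
    [T2Space Θ] {α : Θ ≃ₜ Θ} {f : Θ × unitInterval → Θ × unitInterval}
    (hf : IsForcedIncreasing α f) {p : ℤ → Θ × unitInterval} (hp : ∀ n, f (p n) = p (n + 1))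
    (hp0 : ∀ n, 0 < (p n).2) (hp1 : ∀ n, (p n).2 < 1) {ρ₀ : Θ × unitInterval → unitInterval}
    (hρ₀ : IsFibreJump ρ₀ (p 0)) :
    ∃ ρ : ℤ → Θ × unitInterval → unitInterval, ρ 0 = ρ₀ ∧ (∀ n, IsFibreJump (ρ n) (p n)) ∧
      ∀ n q, ρ (n + 1) (f q) = ρ n q := by
  obtain ⟨R, hRc, hRf, hR1, hRm, hRp⟩ := hf.exists_leftInverse
  -- Morally `ρ₀ ∘ f⁻ⁿ`, with `R` for the inverse; `Int.negSucc k` is `-(k + 1)`, whence the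
  -- exponent `k + 1`.
  let ρ : ℤ → Θ × unitInterval → unitInterval
    | Int.ofNat k => ρ₀ ∘ R^[k]
    | Int.negSucc k => ρ₀ ∘ f^[k + 1]
  refine ⟨ρ, rfl, ?_, ?_⟩
  · have hpos : ∀ k : ℕ, IsFibreJump (ρ₀ ∘ R^[k]) (p k) := by
      intro k
      induction k with
      | zero => exact hρ₀
      | succ k ih =>
        rw [Function.iterate_succ, ← Function.comp_assoc]
        refine ih.comp hRc hR1 hRm fun q => ⟨fun h => ?_, fun h => ?_⟩
        · rw [hRp _ _ (hp0 _) (hp1 _) h, hp, Nat.cast_succ]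
        · rw [h, Nat.cast_succ, ← hp, hRf]
    have hneg : ∀ k : ℕ, IsFibreJump (ρ₀ ∘ f^[k]) (p (-k)) := by
      intro k
      induction k with
      | zero => exact hρ₀
      | succ k ih =>
        have hk : f (p (-((k + 1 : ℕ) : ℤ))) = p (-k) := by
          rw [hp]; congr 1; push_cast; ring
        rw [Function.iterate_succ, ← Function.comp_assoc]
        refine ih.comp hf.continuous hf.fst_eq (fun θ => (hf.strictMono θ).monotone)
          fun q => ⟨fun h => hf.injective (h.trans hk.symm), fun h => h ▸ hk⟩
    rintro (k | k)
    · exact hpos k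
    · exact hneg (k + 1)
  · rintro (k | k) q
    · change ρ₀ (R^[k + 1] (f q)) = ρ₀ (R^[k] q)
      rw [Function.iterate_succ_apply, hRf]
    · rcases k with _ | k
      · rfl
      · rfl

end Jumps

/-! ### The extension and its properties. -/

theorem theorem1 {Θ : Type*} [MetricSpace Θ] [CompactSpace Θ] [Infinite Θ]
    (α : Θ ≃ₜ Θ) (hα_ap : IsAlmostPeriodic α) (hα_min : IsMinimalHomeo α)
    (f : Θ × unitInterval → Θ × unitInterval) (hf : IsForcedIncreasing α f)
    (γ : Θ → unitInterval) (hγ : Continuous γ)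
    (hγ_int : ∀ θ, (γ θ : ℝ) ∈ interior unitInterval)
    (hγ_inv : f '' curveGraph γ = curveGraph γ) :
    ∃ fhat h : Θ × unitInterval → Θ × unitInterval,
      IsFactorMap h fhat f ∧
      (∀ p, (h p).1 = p.1) ∧
      IsForcedIncreasing α fhat ∧
      (∀ θ, Monotone fun x => (h (θ, x)).2) ∧
      Set.InjOn h (h ⁻¹' curveGraph γ)ᶜ ∧
      (∃ C : Set (Θ × unitInterval), C ⊆ curveGraph γ ∧ C.Countable ∧ C.Infinite ∧
        (∀ p ∈ C, ∃ a b : unitInterval, a < b ∧ h ⁻¹' {p} = {p.1} ×ˢ Set.Icc a b) ∧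
        (∀ p ∈ curveGraph γ \ C, ∃ q, h ⁻¹' {p} = {q})) ∧
      (¬ ∃ η : Θ → unitInterval, Continuous η ∧ curveGraph η ⊆ h ⁻¹' curveGraph γ) ∧
      IsPinched (h ⁻¹' curveGraph γ) ∧
      (∃ M ⊆ h ⁻¹' curveGraph γ, IsMinimalSet fhat M ∧
        IsAlmostAutomorphicOn fhat M ∧ ¬ IsAlmostPeriodicOn fhat M) := by

  have hγ0 : ∀ θ, 0 < γ θ ∧ γ θ < 1 := fun θ => by
    have h' : (γ θ : ℝ) ∈ interior (Set.Icc 0 1) := hγ_int θ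
    rw [interior_Icc] at h'
    exact h'
  have hfγ : ∀ θ, f (θ, γ θ) = (α θ, γ (α θ)) := fun θ => by
    have h : f (θ, γ θ) ∈ curveGraph γ := hγ_inv ▸ ⟨(θ, γ θ), rfl, rfl⟩
    have h1 := hf.fst_eq (θ, γ θ)
    exact Prod.ext h1 (h.trans (by rw [h1]))
  obtain ⟨θ₀, θs, hacc, hθs⟩ := exists_accPt_not_mem_orbit α
  let p : ℤ → Θ × unitInterval := fun n => ((α ^ n) θ₀, γ ((α ^ n) θ₀))
  have hpinj : Function.Injective fun n => (p n).1 := hα_min.zpow_injective θ₀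
  have hpf : ∀ n, f (p n) = p (n + 1) := fun n => by
    change f (_, γ _) = _
    have e : α ((α ^ n) θ₀) = (α ^ (n + 1)) θ₀ := by
      rw [add_comm, α.zpow_add_apply, zpow_one]
    rw [hfγ, e]
  have hpγ : ∀ n, p n ∈ curveGraph γ := fun n => rfl
  obtain ⟨ρ₀, hρ₀, hosc⟩ := exists_isFibreJump_not_tendsto hγ θ₀
  have hp0 : p 0 = (θ₀, γ θ₀) := rfl
  obtain ⟨ρ, rfl, hρ, hρf⟩ := hf.exists_isFibreJump_orbit hpf (fun n => (hγ0 _).1)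
    (fun n => (hγ0 _).2) (hp0.symm ▸ hρ₀)
  obtain ⟨Ψ, hΨ1, hΨ2⟩ := exists_homeomorph_blowUp hρ hpinj (fun n => (hγ0 _).1.ne')
    (fun n => (hγ0 _).2.ne)
  have hΨs : ∀ z, (Ψ.symm z).1.1.1 = z.1 := fun z => by rw [← hΨ1, Ψ.apply_symm_apply]
  -- The shift matches `ρ (n + 1) ∘ f = ρ n` and carries the free coordinate at `p (n - 1)` to the
  -- one at `p n`.
  let S : blowUp ρ p → blowUp ρ p := fun q =>
    ⟨(f q.1.1, fun n => q.1.2 (n - 1)), fun n hn => by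
      have h1 : q.1.1 ≠ p (n - 1) := fun h => hn (by
        change f q.1.1 = p n
        rw [h, hpf, sub_add_cancel])
      change q.1.2 (n - 1) = ρ n (f q.1.1)
      rw [q.2 (n - 1) h1, ← hρf, sub_add_cancel]⟩
  have hfc := hf.continuous
  have hS : Continuous S := Continuous.subtype_mk (by fun_prop) _
  let fhat : Θ × unitInterval → Θ × unitInterval := fun z => Ψ (S (Ψ.symm z))
  let h : Θ × unitInterval → Θ × unitInterval := fun z => (Ψ.symm z).1.1
  have hh1 : ∀ z, (h z).1 = z.1 := hΨs
  have hhc : Continuous h := by fun_prop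
  have hsemi : ∀ z, h (fhat z) = f (h z) := fun z => by
    change (Ψ.symm (Ψ (S (Ψ.symm z)))).1.1 = _
    rw [Ψ.symm_apply_apply]
  have hsurj : Function.Surjective h := fun q => by
    refine ⟨Ψ ⟨(q, fun n => ρ n q), fun n _ => rfl⟩, ?_⟩
    change (Ψ.symm (Ψ _)).1.1 = _
    rw [Ψ.symm_apply_apply]
  have hinj : ∀ z z', h z = h z' → (∀ n, h z ≠ p n) → z = z' := fun z z' hz hn => by
    refine Ψ.symm.injective (Subtype.ext (Prod.ext hz (funext fun n => ?_)))
    have h1 : (Ψ.symm z).1.2 n = ρ n (h z) := (Ψ.symm z).2 n (hn n)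
    have h2 : (Ψ.symm z').1.2 n = ρ n (h z') := (Ψ.symm z').2 n fun e => hn n (hz.trans e)
    rw [h1, h2, hz]
  have hle : ∀ θ x x', x ≤ x' ↔ (Ψ.symm (θ, x)).1.1.2 ≤ (Ψ.symm (θ, x')).1.1.2 ∧
      (Ψ.symm (θ, x)).1.2 ≤ (Ψ.symm (θ, x')).1.2 := fun θ x x' => by
    rw [← hΨ2 _ _ (by rw [hΨs, hΨs]), Ψ.apply_symm_apply, Ψ.apply_symm_apply]
  have hfhat : IsForcedIncreasing α fhat := by
    refine ⟨Ψ.continuous.comp (hS.comp Ψ.symm.continuous), fun z => ?_, fun θ => ?_⟩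
    · rw [← hh1, hsemi, hf.fst_eq, hh1]
    -- On each fibre `S` preserves and reflects the product order: `f` does so in the first factor,
    -- the shift in the second.
    · have hmono : ∀ x x', (fhat (θ, x)).2 ≤ (fhat (θ, x')).2 ↔ x ≤ x' := fun x x' => by
        have e : (h (θ, x)).1 = (h (θ, x')).1 := by rw [hh1, hh1]
        rw [hΨ2 _ _ (by
          change (f (h (θ, x))).1 = (f (h (θ, x'))).1
          rw [hf.fst_eq, hf.fst_eq, e]), hle θ x x']
        refine and_congr ?_ ?_
        · have := (hf.strictMono θ).le_iff_le (a := (h (θ, x)).2) (b := (h (θ, x')).2)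
          rwa [show (θ, (h (θ, x)).2) = h (θ, x) from Prod.ext (hh1 (θ, x)).symm rfl,
            show (θ, (h (θ, x')).2) = h (θ, x') from Prod.ext (hh1 (θ, x')).symm rfl] at this
        · constructor
          · intro hu n
            have := hu (n + 1)
            simpa only [S, add_sub_cancel_right] using this
          · exact fun hu n => hu (n - 1)
      exact fun x x' hx => lt_of_not_ge fun hge => hx.not_ge ((hmono x' x).1 hge)
  have hη : ¬ ∃ η : Θ → unitInterval, Continuous η ∧ curveGraph η ⊆ h ⁻¹' curveGraph γ := by
    rintro ⟨η, hηc, hη⟩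
    -- Off `θ₀` this coordinate is `ρ 0 (θ, γ θ)`, so its continuity contradicts the oscillation.
    have hu : Continuous fun θ => (Ψ.symm (θ, η θ)).1.2 0 := by fun_prop
    refine hosc _ ((hu.continuousAt (x := θ₀)).mono_left nhdsWithin_le_nhds |>.congr' ?_)
    filter_upwards [self_mem_nhdsWithin] with θ hθ
    have h1 : h (θ, η θ) = (θ, γ θ) :=
      Prod.ext (hh1 _) ((hη (show (θ, η θ) ∈ curveGraph η from rfl)).trans (by rw [hh1]))
    have h2 : (Ψ.symm (θ, η θ)).1.1 ≠ p 0 := fun h2 =>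
      hθ (congrArg Prod.fst (h1.symm.trans h2))
    rw [(Ψ.symm (θ, η θ)).2 0 h2]
    exact congrArg _ h1
  obtain ⟨⟨θ', zs⟩, hzs⟩ := hsurj (θs, γ θs)
  obtain rfl : θ' = θs := (hh1 _).symm.trans (congrArg Prod.fst hzs)
  have hzK : (θ', zs) ∈ h ⁻¹' curveGraph γ := by
    rw [Set.mem_preimage, hzs]
    rfl
  have hz : ∀ x, (θ', x) ∈ h ⁻¹' curveGraph γ → x = zs := fun x hx => by
    have h1 : h (θ', x) = (θ', γ θ') := Prod.ext (hh1 _) (hx.trans (by rw [hh1]))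
    have h2 := hinj _ _ (h1.trans hzs.symm) fun n hn =>
      hθs n (congrArg Prod.fst (h1.symm.trans hn)).symm
    exact congrArg Prod.snd h2
  have hKcl : IsClosed (h ⁻¹' curveGraph γ) :=
    (isClosed_eq continuous_snd (hγ.comp continuous_fst)).preimage hhc
  have hKmaps : Set.MapsTo fhat (h ⁻¹' curveGraph γ) (h ⁻¹' curveGraph γ) := fun z hz => by
    rw [Set.mem_preimage, hsemi, ← hγ_inv]
    exact ⟨_, hz, rfl⟩
  refine ⟨fhat, h, ⟨hhc, hsurj, funext hsemi⟩, hh1, hfhat, fun θ x x' hx => ((hle θ x x').1 hx).1,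
    fun z hz z' _ hzz => hinj z z' hzz fun n hn => hz (hn ▸ hpγ n : h z ∈ curveGraph γ),
    ⟨Set.range p, Set.range_subset_iff.2 hpγ, Set.countable_range p,
      Set.infinite_range_of_injective fun m n hmn => hpinj (congrArg Prod.fst hmn), ?_, ?_⟩, hη,
    ⟨θ', Set.encard_eq_one.2 ⟨zs, Set.eq_singleton_iff_unique_mem.2 ⟨hzK, hz⟩⟩⟩,
    exists_minimalSet_almostAutomorphic hα_ap hα_min hfhat hKcl hKmaps hzK hz hη⟩
  · rintro _ ⟨n, rfl⟩
    -- The segment over `p n`, parametrised by its free coordinate; `c = 0` and `c = 1` give its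
    -- ends.
    let e : unitInterval → blowUp ρ p := fun c =>
      ⟨(p n, Function.update (fun m => ρ m (p n)) n c), fun m hm => by
        have hmn : m ≠ n := fun h => hm (h ▸ rfl)
        simp [Function.update_of_ne hmn]⟩
    have hlt : (Ψ (e 0)).2 < (Ψ (e 1)).2 := lt_of_not_ge fun hge => by
      have h1 := ((hΨ2 (e 1) (e 0) rfl).1 hge).2 n
      simp only [e, Function.update_self] at h1
      exact absurd h1 zero_lt_one.not_ge
    refine ⟨(Ψ (e 0)).2, (Ψ (e 1)).2, hlt, Set.ext fun ⟨θ, x⟩ => ?_⟩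
    have hx : x = (Ψ (Ψ.symm (θ, x))).2 := by rw [Ψ.apply_symm_apply]
    rw [Set.mem_preimage, Set.mem_singleton_iff, Set.mem_prod, Set.mem_singleton_iff]
    constructor
    · intro hpn
      have hθ : θ = (p n).1 := by rw [← hpn, hh1]
      have hpn' : (Ψ.symm (θ, x)).1.1 = p n := hpn
      have hu : ∀ m, m ≠ n → (Ψ.symm (θ, x)).1.2 m = ρ m (p n) := fun m hm => by
        rw [(Ψ.symm (θ, x)).2 m, hpn']
        rw [hpn']
        exact fun h => hm (hpinj (congrArg Prod.fst h)).symm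
      refine ⟨hθ, ?_, ?_⟩
      · change _ ≤ x
        rw [hx, hΨ2 _ _ (congrArg Prod.fst hpn').symm]
        refine ⟨(congrArg Prod.snd hpn').ge, fun m => ?_⟩
        rcases eq_or_ne m n with rfl | hm
        · simpa only [e, Function.update_self] using unitInterval.nonneg'
        · simp only [e, Function.update_of_ne hm, hu m hm, le_refl]
      · change x ≤ _
        rw [hx, hΨ2 _ _ (congrArg Prod.fst hpn')]
        refine ⟨(congrArg Prod.snd hpn').le, fun m => ?_⟩
        rcases eq_or_ne m n with rfl | hm
        · simpa only [e, Function.update_self] using unitInterval.le_one'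
        · simp only [e, Function.update_of_ne hm, hu m hm, le_refl]
    · rintro ⟨hθ, h0, h1⟩
      have hθ' : (Ψ.symm (θ, x)).1.1.1 = (p n).1 := (hΨs _).trans hθ
      change _ ≤ x at h0
      change x ≤ _ at h1
      rw [hx, hΨ2 _ _ hθ'.symm] at h0
      rw [hx, hΨ2 _ _ hθ'] at h1
      exact Prod.ext hθ' (h1.1.antisymm h0.1)
  · rintro q ⟨-, hq⟩
    obtain ⟨z, hz⟩ := hsurj q
    refine ⟨z, Set.eq_singleton_iff_unique_mem.2 ⟨hz, fun z' hz' => (hinj z z' ?_ ?_).symm⟩⟩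
    · rw [hz, hz']
    · exact fun n hn => hq ⟨n, hn.symm.trans hz⟩
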